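/- **Setting.** Let $\mathcal E$ be a finite set of items. Two streams $S=[s_1,\dots,s_n]$, $S'=[s_1',\dots,s_n']$ over $\mathcal E$ are *neighboring* if they differ in exactly one position. For a randomized mechanism $\mathcal M$ on streams of length $n$ (with measurable output space): - $\mathcal M$ is *event-level $(\varepsilon,\delta)$-DP* if $\Pr[\mathcal M(S)\in O]\le e^{\varepsilon}\Pr[\mathcal M(S')\in O]+\delta$ for all neighboring $S,S'$ and all measurable $O$; - $\mathcal M$ is *$\rho$-zCDP* if $D_\lambda(\mathcal M(S)\,\|\,\mathcal M(S'))\le\rho\lambda$ for all neighboring $S,S'$ and all $\lambda\in(1,\infty)$, where $D_\lambda(P\|Q)=\frac1{\lambda-1}\ln\int(\frac{dP}{dQ})^{\lambda}\,dQ$ if $P\ll Q$, and $D_\lambda(P\|Q)=\infty$ otherwise. **The mechanism DPSW-Sketch.** Parameters: window size $w\ge1$, factors $\alpha,\beta\in(0,1)$, sketch height and width $a,b\ge1$, budget $\rho>0$, reals $\gamma,\zeta$. Put $L=\lceil w^{\beta}\rceil$. *Checkpoints.* Start with the empty list $I$. For $i=L,L-1,\dots,1$: append $i$ to $I$; then for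 $j=1,2,\dots,|I|-2$ in turn find the largest $k>j$ with $I[k]\ge(1-\alpha)I[j]$ (if there is one) and delete all entries strictly between positions $j$ and $k$. Put $I'[j]=L-I[j]+1$. *Sketches.* Cut the stream into consecutive substreams of length $L$ (the last one may be shorter). In a substream that starts at time $\tau$, build the following private count-min sketches (PCMSs): - one on the full substream, with budget $\rho(2\alpha-\alpha^2)$; - for each $j=2,\dots,|I|$, a prefix sketch on the items of the substream at times $\le v_j=\tau+I[j]-1$, with budget $\rho\,\alpha^{j-2}(1-\alpha)^3/2$; - for each $j=2,\dots,|I|$, a suffix sketch on the items of the substream at times $\ge u_j=\tau+I'[j]$, with budget $\rho\,\alpha^{j-2}(1-\alpha)^3/2$. A PCMS with budget $\rho'$ is an $a\times b$ array of counters that are initialized independently with $\mathcal N(0,a/\rho')$, with hash functions $h_1,\dots,h_a:\mathcal E\to[b]$. Each item $s$ that it receives increases the counters $(r,h_r(s))$, $r\in[a]$, by $1$. Its answer to a query $e\in\mathcal E$ is $\min_{r}\widehat{\mathcal C}[r,h_r(e)]$. The hash functions of all PCMSs are drawn from an arbitrary joint distribution $\nu$ (for example, independent and uniform), independently of the noise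 and of the stream. *Queries.* At time $t$ the estimate $\widehat f_{e,t}$ is computed from the state at time $t$. Let $l$ be the current substream and $l'$ the oldest substream that meets the window of times $[\max(t-w+1,1),t]$. Then $\widehat f_{e,t}$ is the sum of the following answers: - on $l$, the answer of the longest full or prefix sketch that is already completed at time $t$; - on each substream strictly between $l'$ and $l$, the answer of its full sketch; - on $l'$, if $l'<l$, the answer of the suffix sketch with the latest start $u_j\le\max(t-w+1,1)$, or of the full sketch if there is no such suffix sketch. The reported heavy hitters are $\widehat{\mathcal H}_t=\{e:\widehat f_{e,t}\ge(\gamma-\zeta)w\}$. *Output.* On a stream of length $n$, the mechanism reveals jointly all hash functions, the counters of all PCMSs of all substreams as they stand when the PCMS is completed (or at time $n$, for those not yet completed), and $\widehat f_{e,t}$ and $\widehat{\mathcal H}_t$ for all $e\in\mathcal E$ and all $t=1,\dots,n$. **Theorem.** For every $n$ and all such parameters: 1. For every $\rho>0$, DPSW-Sketch with budget $\rho$ is $\rho$-zCDP, and it is event-level $\big(\rho+2\sqrt{\rho\ln(1/\delta)},\,\delta\big)$-DP for every $\delta\in(0,1)$. 2. For every $\varepsilon>0$ and $\delta\in(0,1)$,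 the number $$\rho=\Big(\sqrt{\varepsilon+\ln(1/\delta)}-\sqrt{\ln(1/\delta)}\Big)^2$$ is positive and satisfies $\rho+2\sqrt{\rho\ln(1/\delta)}=\varepsilon$, and DPSW-Sketch with this budget $\rho$ is event-level $(\varepsilon,\delta)$-DP. -/

import Mathlib

open MeasureTheory ProbabilityTheory

noncomputable section

namespace DPSW

/-! ### Privacy notions -/

/-- Two streams of the same length are neighboring if they differ in exactly one position. -/
def Neighboring {E : Type*} {n : ℕ} (S S' : Fin n → E) : Prop :=
  ∃ i, S i ≠ S' i ∧ ∀ j, j ≠ i → S j = S' j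

/-- The Rényi divergence of order `lam > 1`:
`(lam - 1)⁻¹ * log ∫ (dP/dQ) ^ lam dQ` if `P ≪ Q`, and `∞` otherwise. -/
def renyiDiv {Ω : Type*} [MeasurableSpace Ω] (lam : ℝ) (P Q : Measure Ω) : EReal :=
  open Classical in
  if P ≪ Q then
    (((lam - 1)⁻¹ : ℝ) : EReal) * ENNReal.log (∫⁻ x, (P.rnDeriv Q x) ^ lam ∂Q)
  else ⊤

/-- `ρ`-zCDP of a randomized mechanism on streams, given by its output laws. -/
def IsZCDP {E : Type*} {n : ℕ} {Ω : Type*} [MeasurableSpace Ω]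
    (M : (Fin n → E) → Measure Ω) (ρ : ℝ) : Prop :=
  ∀ S S' : Fin n → E, Neighboring S S' → ∀ lam : ℝ, 1 < lam →
    renyiDiv lam (M S) (M S') ≤ ((ρ * lam : ℝ) : EReal)

/-- Event-level `(ε, δ)`-differential privacy. -/
def IsDP {E : Type*} {n : ℕ} {Ω : Type*} [MeasurableSpace Ω]
    (M : (Fin n → E) → Measure Ω) (ε δ : ℝ) : Prop :=
  ∀ S S' : Fin n → E, Neighboring S S' → ∀ O : Set Ω, MeasurableSet O →
    M S O ≤ ENNReal.ofReal (Real.exp ε) * M S' O + ENNReal.ofReal δ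

/-- The zCDP budget for given `ε`, `δ`: the nonnegative solution `ρ` of
`ρ + 2 √(ρ log (1/δ)) = ε`. -/
def rhoOf (ε δ : ℝ) : ℝ :=
  (√(ε + Real.log (1 / δ)) - √(Real.log (1 / δ))) ^ 2

/-! ### Checkpoints -/

open Classical in
/-- One pruning step at the (0-based) position `j`: find the largest `k > j` with
`I[k] ≥ (1 - α) I[j]` and delete everything strictly between `j` and `k`
(if there is no such `k`, nothing is deleted). -/
def prune (α : ℝ) (I : List ℕ) (j : ℕ) : List ℕ :=
  let K := (Finset.Ioo j I.length).filter
    (fun k => (1 - α) * (I.getD j 0 : ℝ) ≤ (I.getD k 0 : ℝ))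
  I.take (j + 1) ++ I.drop (max (j + 1) (K.sup id))

/-- Append the index `i`, then prune at the first `|I| - 2` positions in turn. -/
def appendIndex (α : ℝ) (I : List ℕ) (i : ℕ) : List ℕ :=
  (List.range ((I ++ [i]).length - 2)).foldl (prune α) (I ++ [i])

/-- The list `I` of checkpoint indices of a substream of length `L`, obtained by processing
`i = L, L - 1, …, 1`. It is strictly decreasing. -/
def checkpointList (α : ℝ) (L : ℕ) : List ℕ :=
  ((List.range L).map (fun k => L - k)).foldl (appendIndex α) []

/-! ### The sketch -/

/-- The structural parameters: window size `w`, sketch height `a` and width `b`, and the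
factors `α`, `β`. -/
structure Params where
  w : ℕ
  a : ℕ
  b : ℕ
  α : ℝ
  β : ℝ

namespace Params

/-- The length `⌈w ^ β⌉` of each substream. -/
def L (p : Params) : ℕ := ⌈(p.w : ℝ) ^ p.β⌉₊

/-- The checkpoint indices. -/
def I (p : Params) : List ℕ := checkpointList p.α p.L

/-- The PCMSs of one substream: the one for the full substream, and, for every `i`, the prefix
sketch and the suffix sketch of the checkpoint with 1-based number `j = i + 2 ∈ {2, …, |I|}`. -/
abbrev Idx (p : Params) : Type :=
  Unit ⊕ Fin (p.I.length - 1) ⊕ Fin (p.I.length - 1)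

/-- The checkpoint index `I[j]` with 1-based number `j = i + 2`. -/
def cp (p : Params) (i : Fin (p.I.length - 1)) : ℕ := p.I.getD (i + 1) 0

/-- The time at which the `k`-th substream (`k = 0, 1, …`) starts; times start at `1`. -/
def start (p : Params) (k : ℕ) : ℕ := k * p.L + 1

/-- The end time `v = t + I[j] - 1` of a prefix sketch of a substream starting at time `t`. -/
def v (p : Params) (k : ℕ) (i : Fin (p.I.length - 1)) : ℕ := p.start k + p.cp i - 1

/-- The start time `u = t + I'[j]`, `I'[j] = L - I[j] + 1`, of a suffix sketch of a substream
starting at time `t`. -/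
def u (p : Params) (k : ℕ) (i : Fin (p.I.length - 1)) : ℕ :=
  p.start k + (p.L - p.cp i + 1)

/-- Whether a PCMS of the `k`-th substream receives the item that arrives at time `t`, where `t`
is a time of that substream. -/
def receives (p : Params) (k : ℕ) : p.Idx → ℕ → Prop
  | Sum.inl _, _ => True
  | Sum.inr (Sum.inl i), t => t ≤ p.v k i
  | Sum.inr (Sum.inr i), t => p.u k i ≤ t

/-- The share of the budget `ρ` of each PCMS of a substream. -/
def budget (p : Params) (ρ : ℝ) : p.Idx → ℝ
  | Sum.inl _ => ρ * (2 * p.α - p.α ^ 2)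
  | Sum.inr (Sum.inl i) => ρ * p.α ^ (i : ℕ) * (1 - p.α) ^ 3 / 2
  | Sum.inr (Sum.inr i) => ρ * p.α ^ (i : ℕ) * (1 - p.α) ^ 3 / 2

/-- The number `⌈n / L⌉` of substreams of a stream of length `n`. -/
def numSub (p : Params) (n : ℕ) : ℕ := (n + p.L - 1) / p.L

/-- The hash functions of all PCMSs: `a` hash functions `E → [b]` for each of them. -/
abbrev Hashes (p : Params) (n : ℕ) (E : Type*) : Type _ :=
  Fin (p.numSub n) × p.Idx → Fin p.a → E → Fin p.b

/-- Positions of counters: substream, PCMS, row, column. -/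
abbrev Slot (p : Params) (n : ℕ) : Type :=
  Fin (p.numSub n) × p.Idx × Fin p.a × Fin p.b

/-- Real arrays with one entry for each counter of each PCMS. -/
abbrev Counters (p : Params) (n : ℕ) : Type := p.Slot n → ℝ

/-- The law of the initial values of the counters: independent, and `N(0, a / ρ')` in a PCMS
with budget `ρ'`. -/
def noiseLaw (p : Params) (ρ : ℝ) (n : ℕ) : Measure (p.Counters n) :=
  Measure.pi fun s => gaussianReal 0 (Real.toNNReal ((p.a : ℝ) / p.budget ρ s.2.1))

variable {E : Type*} {n : ℕ}

open Classical in
/-- The counters at time `t`: the initial noise plus the number of items that arrived until then,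
were added to the PCMS, and are mapped to the given column by the hash function of the row.
The item `S i` arrives at time `i + 1` and belongs to the substream number `i / L`. -/
def countersAt (p : Params) (S : Fin n → E) (h : p.Hashes n E) (Z : p.Counters n) (t : ℕ) :
    p.Counters n := fun s =>
  Z s + ((Finset.univ.filter (fun i : Fin n =>
    (i : ℕ) + 1 ≤ t ∧ (i : ℕ) / p.L = s.1 ∧ p.receives s.1 s.2.1 (i + 1) ∧
      h (s.1, s.2.1) s.2.2.1 (S i) = s.2.2.2)).card : ℝ)

/-- The estimate of the frequency of `e` by one PCMS: the minimum over the rows. -/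
def cmsQuery (p : Params) (h : p.Hashes n E) (C : p.Counters n)
    (k : Fin (p.numSub n)) (j : p.Idx) (e : E) : ℝ :=
  ⨅ r : Fin p.a, C (k, j, r, h (k, j) r e)

/-- First time `max (t - w + 1) 1` of the window at time `t`. -/
def winStart (p : Params) (t : ℕ) : ℕ := max (t + 1 - p.w) 1

/-- The PCMS used for the current substream at time `t`: the longest one among the full and the
prefix sketches which is completed at time `t` (as `I` is decreasing, the first such one). -/
def selectPrefix (p : Params) (k t : ℕ) : Option p.Idx :=
  if p.start k + p.L - 1 ≤ t then some (Sum.inl ())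
  else ((List.finRange (p.I.length - 1)).find? (fun i => decide (p.v k i ≤ t))).map
    (fun i => Sum.inr (Sum.inl i))

/-- The PCMS used for the oldest substream in the window: the suffix sketch with the latest start
not after the first time `q` of the window (as `I` is decreasing, the last such one); the full
sketch if there is no such suffix sketch. -/
def selectSuffix (p : Params) (k q : ℕ) : p.Idx :=
  match (List.finRange (p.I.length - 1)).reverse.find? (fun i => decide (p.u k i ≤ q)) with
  | some i => Sum.inr (Sum.inr i)
  | none => Sum.inl ()

/-- The frequency estimate for `e` at time `t ≥ 1` from the counters `C` at time `t`: with `cur`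
the current substream and `old` the oldest substream that meets the window, the sum of the answers
of the selected prefix sketch on `cur`, the full sketches strictly between, and the selected suffix
sketch on `old` (if `old < cur`). -/
def freqQuery (p : Params) (h : p.Hashes n E) (C : p.Counters n) (t : ℕ) (e : E) : ℝ :=
  let cur := (t - 1) / p.L
  let old := (p.winStart t - 1) / p.L
  ∑ k : Fin (p.numSub n),
    if (k : ℕ) = cur then
      match p.selectPrefix k t with
      | some j => p.cmsQuery h C k j e
      | none => 0
    else if old < k ∧ k < cur then p.cmsQuery h C k (Sum.inl ()) e
    else if (k : ℕ) = old ∧ k < cur then p.cmsQuery h C k (p.selectSuffix k (p.winStart t)) e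
    else 0

/-- What is revealed on a stream of length `n`: the hash functions, the counters of all PCMSs of
all substreams when they are completed (or when the stream ends), the frequency estimates of all
items at all times, and the reported sets of heavy hitters at all times. -/
abbrev Release (p : Params) (n : ℕ) (E : Type*) : Type _ :=
  p.Hashes n E × p.Counters n × (Fin n → E → ℝ) × (Fin n → Set E)

/-- The run of DPSW-Sketch on `S` with given hash functions and initial noise. The frequency
estimate at time `t = i + 1` is computed from the state at time `t`; the items `e` with estimate at
least `(γ - ζ) w` are reported as heavy hitters. -/
def run (p : Params) (γ ζ : ℝ) (S : Fin n → E) (x : p.Hashes n E × p.Counters n) :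
    p.Release n E :=
  let est : Fin n → E → ℝ := fun i e =>
    p.freqQuery x.1 (p.countersAt S x.1 x.2 (i + 1)) (i + 1) e
  (x.1, p.countersAt S x.1 x.2 n, est, fun i => {e | (γ - ζ) * p.w ≤ est i e})

/-- The mechanism DPSW-Sketch with budget `ρ`: the law of the release, for hash functions drawn
from `ν` independently of the Gaussian noise. -/
def mechanism (p : Params) (γ ζ ρ : ℝ) (ν : Measure (p.Hashes n E)) (S : Fin n → E) :
    Measure (p.Release n E) :=
  (ν.prod (p.noiseLaw ρ n)).map (p.run γ ζ S)

instance (p : Params) (ρ : ℝ) (n : ℕ) : IsProbabilityMeasure (p.noiseLaw ρ n) := by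
  unfold noiseLaw; infer_instance

/-- The run depends measurably on the random choices. -/
theorem measurable_run [Finite E] (p : Params) (γ ζ : ℝ) (S : Fin n → E) :
    Measurable (p.run γ ζ S) := by
  refine measurable_from_prod_countable_right fun h => ?_
  have hC : ∀ t, Measurable fun Z : p.Counters n => p.countersAt S h Z t := fun t =>
    measurable_pi_lambda _ fun s => (measurable_pi_apply s).add_const _
  have hq : ∀ t k j e, Measurable fun Z : p.Counters n =>
      p.cmsQuery h (p.countersAt S h Z t) k j e := fun t k j e =>
    Measurable.iInf fun r =>
      measurable_pi_iff.1 (hC t) (k, j, r, h (k, j) r e)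
  have hf : ∀ t e, Measurable fun Z : p.Counters n =>
      p.freqQuery h (p.countersAt S h Z t) t e := by
    intro t e
    refine Finset.measurable_sum _ fun k _ => ?_
    split_ifs
    · cases p.selectPrefix k t with
      | none => exact measurable_const
      | some j => exact hq t k j e
    · exact hq _ _ _ _
    · exact hq _ _ _ _
    · exact measurable_const
  refine measurable_const.prodMk ((hC n).prodMk (Measurable.prodMk ?_ ?_))
  · exact measurable_pi_lambda _ fun i => measurable_pi_lambda _ fun e => hf _ e
  · refine measurable_pi_lambda _ fun i => measurable_set_iff.2 fun e => ?_
    exact measurableSet_setOfPred.1 (measurableSet_le measurable_const (hf _ e))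

instance [Finite E] (p : Params) (γ ζ ρ : ℝ) (ν : Measure (p.Hashes n E))
    [IsProbabilityMeasure ν] (S : Fin n → E) :
    IsProbabilityMeasure (p.mechanism γ ζ ρ ν S) :=
  Measure.isProbabilityMeasure_map (p.measurable_run γ ζ S).aemeasurable

end Params

end DPSW

end

/-! An estimate at time `t` reads only PCMSs that are already complete: on the current substream by
the choice of the prefix, on earlier ones because the substream has ended. So the whole release is a
fixed measurable function of the hash functions and the final counters (`freqQuery_eq_final`). The
final counters are noise plus counts, so replacing `S'` by `S` only translates the Gaussian noise by
a vector depending on the hashes (`run_eq_run_shift`). By data processing it suffices to bound the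
Rényi divergence of this translation, uniformly over the hashes.

A translation by `d` of independent Gaussians of variances `v` has divergence `lam * ∑ d² / (2 v)`.
One changed item alters at most two counters per row, each by one, and only in its own substream.
With variance `a / ρ'`, a PCMS therefore costs at most `2a * ρ' / (2a) = ρ'`, and the budgets of one
substream sum to at most `ρ` by a geometric series (`sum_counterShift_sq_le`). This accounting sees
only the number of checkpoints, not their positions.

Approximate DP follows by a tail bound on the density at the best order `lam` (`IsZCDP.isDP`). -/

namespace DPSW

open scoped ENNReal NNReal

/-! ### Rényi divergence: data processing and conversion to approximate DP -/

section Renyi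

variable {Ω Ω' : Type*} [MeasurableSpace Ω] [MeasurableSpace Ω']

theorem renyiDiv_le_iff {lam : ℝ} (hlam : 1 < lam) (P Q : Measure Ω) (c : ℝ) :
    renyiDiv lam P Q ≤ (c : EReal) ↔
      P ≪ Q ∧ ∫⁻ x, (P.rnDeriv Q x) ^ lam ∂Q ≤ ENNReal.ofReal (Real.exp ((lam - 1) * c)) := by
  unfold renyiDiv
  split_ifs with h
  · have h0 : (0 : EReal) < ((lam - 1 : ℝ) : EReal) := by exact_mod_cast sub_pos.2 hlam
    rw [EReal.coe_inv, ← EReal.div_eq_inv_mul, EReal.div_le_iff_le_mul h0 (EReal.coe_ne_top _),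
      ← EReal.coe_mul]
    nth_rw 1 [← Real.log_exp ((lam - 1) * c)]
    rw [← ENNReal.log_ofReal_of_pos (Real.exp_pos _), ENNReal.log_le_log_iff]
    simp [h]
  · simp [h]

/-- Data processing for the moments of a density. -/
theorem lintegral_rnDeriv_map_rpow_le (Q : Measure Ω) [IsFiniteMeasure Q] {g : Ω → ℝ≥0∞}
    (hg : Measurable g) {f : Ω → Ω'} (hf : Measurable f) {lam : ℝ} (hlam : 1 < lam) :
    ∫⁻ y, (((Q.withDensity g).map f).rnDeriv (Q.map f) y) ^ lam ∂(Q.map f)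
      ≤ ∫⁻ x, g x ^ lam ∂Q := by
  set P' := (Q.withDensity g).map f
  set r := P'.rnDeriv (Q.map f)
  have hr : Measurable r := Measure.measurable_rnDeriv _ _
  have hPQ : P' ≪ Q.map f := (withDensity_absolutelyContinuous Q g).map hf
  have hl0 : 0 < lam := by linarith
  have hl1 : 0 < lam - 1 := by linarith
  have hconj : (lam / (lam - 1)).HolderConjugate lam :=
    (Real.HolderConjugate.conjExponent hlam).symm
  set B := ∫⁻ x, g x ^ lam ∂Q
  -- Young's inequality will bound `A` by a multiple of itself plus `B / lam`. Absorbing that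
  -- multiple needs `A` finite, hence the truncation of the density at `N`; monotone convergence
  -- removes it at the end.
  have key : ∀ N : ℕ, ∫⁻ y, (min (r y) N) ^ lam ∂(Q.map f) ≤ B := by
    intro N
    set A := ∫⁻ y, (min (r y) N) ^ lam ∂(Q.map f)
    have hm : Measurable fun y => min (r y) (N : ℝ≥0∞) := hr.min measurable_const
    have hmf : Measurable fun x => min (r (f x)) (N : ℝ≥0∞) := hm.comp hf
    have hA : A ≠ ∞ := by
      refine ne_top_of_le_ne_top ?_
        (lintegral_mono fun y => ENNReal.rpow_le_rpow (min_le_right (r y) (N : ℝ≥0∞)) hl0.le)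
      rw [lintegral_const]
      exact ENNReal.mul_ne_top (ENNReal.rpow_ne_top_of_nonneg hl0.le (by simp))
        (measure_ne_top _ _)
    have h1 : A ≤ ∫⁻ x, (min (r (f x)) N) ^ (lam - 1) * g x ∂Q := by
      calc A ≤ ∫⁻ y, r y * (min (r y) N) ^ (lam - 1) ∂(Q.map f) := by
            refine lintegral_mono fun y => ?_
            have : (min (r y) (N : ℝ≥0∞)) ^ lam
                = min (r y) N * (min (r y) (N : ℝ≥0∞)) ^ (lam - 1) := by
              conv_lhs => rw [show lam = 1 + (lam - 1) by ring]
              rw [ENNReal.rpow_add_of_nonneg _ _ zero_le_one hl1.le, ENNReal.rpow_one]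
            rw [this]
            exact mul_le_mul_left (min_le_left _ _) _
        _ = ∫⁻ y, (min (r y) N) ^ (lam - 1) ∂P' :=
            lintegral_rnDeriv_mul hPQ (hm.pow_const _).aemeasurable
        _ = ∫⁻ x, (min (r (f x)) N) ^ (lam - 1) * g x ∂Q := by
            rw [lintegral_map (hm.pow_const _) hf, lintegral_withDensity_eq_lintegral_mul _ hg
              (hmf.pow_const _)]
            exact lintegral_congr fun x => mul_comm _ _
    -- With exponents `lam / (lam - 1)` and `lam`, the power `lam - 1` of the truncated density
    -- becomes the power `lam`, so its integral is `A` again. The coefficient of `A` is `1 - 1 /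
    -- lam`, which leaves `A ≤ B`.
    have h2 : A ≤ A / ENNReal.ofReal (lam / (lam - 1)) + B / ENNReal.ofReal lam := by
      refine h1.trans ((lintegral_mono fun x => ENNReal.young_inequality _ _ hconj).trans ?_)
      rw [lintegral_add_right _ ((hg.pow_const _).div_const _)]
      simp only [div_eq_mul_inv]
      rw [lintegral_mul_const _ (hg.pow_const _),
        lintegral_mul_const _ ((hmf.pow_const _).pow_const _)]
      simp only [A]
      rw [lintegral_map (hm.pow_const _) hf]
      refine add_le_add_left (mul_le_mul_left (le_of_eq (lintegral_congr fun x => ?_)) _) _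
      rw [← ENNReal.rpow_mul]
      congr 1
      field_simp
    by_cases hB : B = ∞
    · simp [hB]
    lift A to NNReal using hA with A'
    lift B to NNReal using hB with B'
    have h3 : (A' : ℝ) ≤ A' / (lam / (lam - 1)) + B' / lam := by
      have := ENNReal.toReal_mono (by
        refine ENNReal.add_ne_top.2 ⟨ENNReal.div_ne_top ENNReal.coe_ne_top ?_,
          ENNReal.div_ne_top ENNReal.coe_ne_top ?_⟩
        · simpa using div_pos hl0 hl1
        · simpa using hl0) h2
      rw [ENNReal.toReal_add (ENNReal.div_ne_top ENNReal.coe_ne_top (by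
          simpa using div_pos hl0 hl1))
        (ENNReal.div_ne_top ENNReal.coe_ne_top (by simpa using hl0)), ENNReal.toReal_div,
        ENNReal.toReal_div, ENNReal.toReal_ofReal (div_pos hl0 hl1).le,
        ENNReal.toReal_ofReal hl0.le] at this
      simpa using this
    have h4 : (A' : ℝ) ≤ B' := by
      field_simp at h3
      nlinarith
    exact_mod_cast h4
  have hsup : ∀ y, r y ^ lam = ⨆ N : ℕ, (min (r y) N) ^ lam := by
    intro y
    have h1 : (⨆ N : ℕ, min (r y) (N : ℝ≥0∞)) = r y := by
      rw [← inf_iSup_eq, ENNReal.iSup_natCast, inf_top_eq]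
    conv_lhs => rw [← h1]
    exact (ENNReal.orderIsoRpow lam hl0).map_iSup _
  simp_rw [hsup]
  rw [lintegral_iSup (fun N => (hr.min measurable_const).pow_const _)]
  · exact iSup_le key
  · intro M N hMN y
    exact ENNReal.rpow_le_rpow (min_le_min le_rfl (by exact_mod_cast hMN)) hl0.le

theorem renyiDiv_map_withDensity_le (Q : Measure Ω) [IsFiniteMeasure Q] {g : Ω → ℝ≥0∞}
    (hg : Measurable g) {f : Ω → Ω'} (hf : Measurable f) {lam c : ℝ} (hlam : 1 < lam)
    (h : ∫⁻ x, g x ^ lam ∂Q ≤ ENNReal.ofReal (Real.exp ((lam - 1) * c))) :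
    renyiDiv lam ((Q.withDensity g).map f) (Q.map f) ≤ (c : EReal) :=
  (renyiDiv_le_iff hlam _ _ _).2 ⟨(withDensity_absolutelyContinuous Q g).map hf,
    (lintegral_rnDeriv_map_rpow_le Q hg hf hlam).trans h⟩

/-- The tail bound that converts a Rényi divergence bound into approximate indistinguishability. -/
theorem measure_le_of_renyiDiv_le (P Q : Measure Ω) [SigmaFinite P] [SigmaFinite Q]
    {lam c : ℝ} (hlam : 1 < lam) (h : renyiDiv lam P Q ≤ (c : EReal)) (ε : ℝ) {O : Set Ω}
    (hO : MeasurableSet O) :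
    P O ≤ ENNReal.ofReal (Real.exp ε) * Q O
      + ENNReal.ofReal (Real.exp ((lam - 1) * (c - ε))) := by
  obtain ⟨hPQ, hA⟩ := (renyiDiv_le_iff hlam P Q c).1 h
  have hl1 : 0 < lam - 1 := by linarith
  set r := P.rnDeriv Q
  have hr : Measurable r := Measure.measurable_rnDeriv _ _
  -- Above the threshold `exp ε`, Markov's trick: `1 ≤ (r / exp ε) ^ (lam - 1)`.
  have hpt : ∀ x, r x ≤ ENNReal.ofReal (Real.exp ε)
      + ENNReal.ofReal (Real.exp (-ε * (lam - 1))) * r x ^ lam := by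
    intro x
    rcases le_total (r x) (ENNReal.ofReal (Real.exp ε)) with hx | hx
    · exact hx.trans le_self_add
    · refine le_trans ?_ le_add_self
      have h1 : (1 : ℝ≥0∞) ≤ ENNReal.ofReal (Real.exp (-ε * (lam - 1))) * r x ^ (lam - 1) := by
        have := ENNReal.rpow_le_rpow hx hl1.le
        refine le_trans ?_ (mul_le_mul_right this _)
        rw [ENNReal.ofReal_rpow_of_pos (Real.exp_pos _), ← ENNReal.ofReal_mul (Real.exp_pos _).le,
          ← Real.exp_mul, ← Real.exp_add]
        simp
      calc r x = 1 * r x := (one_mul _).symm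
        _ ≤ ENNReal.ofReal (Real.exp (-ε * (lam - 1))) * r x ^ (lam - 1) * r x :=
            mul_le_mul_left h1 _
        _ = ENNReal.ofReal (Real.exp (-ε * (lam - 1))) * r x ^ lam := by
            have := ENNReal.rpow_add_of_nonneg (x := r x) _ _ hl1.le zero_le_one
            rw [sub_add_cancel, ENNReal.rpow_one] at this
            rw [this, mul_assoc]
  calc P O = ∫⁻ x in O, r x ∂Q := (Measure.setLIntegral_rnDeriv' hPQ hO).symm
    _ ≤ ∫⁻ x in O, (ENNReal.ofReal (Real.exp ε)
          + ENNReal.ofReal (Real.exp (-ε * (lam - 1))) * r x ^ lam) ∂Q := lintegral_mono hpt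
    _ = ENNReal.ofReal (Real.exp ε) * Q O
          + ENNReal.ofReal (Real.exp (-ε * (lam - 1))) * ∫⁻ x in O, r x ^ lam ∂Q := by
        rw [lintegral_add_left measurable_const, lintegral_const, Measure.restrict_apply_univ,
          lintegral_const_mul _ (hr.pow_const _)]
    _ ≤ _ := by
        refine add_le_add_right ?_ _
        refine (mul_le_mul_right ((setLIntegral_le_lintegral _ _).trans hA) _).trans ?_
        rw [← ENNReal.ofReal_mul (Real.exp_pos _).le, ← Real.exp_add]
        exact le_of_eq (by congr 2; ring)

theorem IsZCDP.isDP {E : Type*} {n : ℕ} {M : (Fin n → E) → Measure Ω}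
    [∀ S, IsProbabilityMeasure (M S)] {ρ : ℝ} (h : IsZCDP M ρ) (hρ : 0 < ρ) {δ : ℝ} (hδ : 0 < δ)
    (hδ1 : δ < 1) : IsDP M (ρ + 2 * √(ρ * Real.log (1 / δ))) δ := by
  intro S S' hS O hO
  set l := Real.log (1 / δ) with hl_def
  have hl : 0 < l := Real.log_pos (by rw [lt_div_iff₀ hδ]; linarith)
  -- `s = lam - 1` minimizes the exponent `s * (ρ * (1 + s) - ε)` for `ε = ρ + 2 * √(ρ * l) = ρ + 2
  -- * ρ * s`; the minimum is `-ρ * s ^ 2 = -l`, which is `log δ`.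
  set s := √(l / ρ)
  have hs : 0 < s := Real.sqrt_pos.2 (div_pos hl hρ)
  have hss : s ^ 2 * ρ = l := by
    rw [Real.sq_sqrt (div_pos hl hρ).le]; field_simp
  have hsqrt : √(ρ * l) = ρ * s := by
    rw [← hss, show ρ * (s ^ 2 * ρ) = (ρ * s) ^ 2 by ring, Real.sqrt_sq (by positivity)]
  have := measure_le_of_renyiDiv_le (M S) (M S') (lam := 1 + s) (by linarith)
    (h S S' hS (1 + s) (by linarith)) (ρ + 2 * √(ρ * l)) hO
  refine this.trans (add_le_add_right (le_of_eq ?_) _)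
  rw [hsqrt, show (1 + s - 1) * (ρ * (1 + s) - (ρ + 2 * (ρ * s))) = -(s ^ 2 * ρ) by ring, hss,
    hl_def, one_div, Real.log_inv, neg_neg, Real.exp_log hδ]

end Renyi

theorem rhoOf_pos {ε δ : ℝ} (hε : 0 < ε) (hδ : 0 < δ) (hδ1 : δ < 1) : 0 < rhoOf ε δ := by
  have hl : 0 < Real.log (1 / δ) := Real.log_pos (by rw [lt_div_iff₀ hδ]; linarith)
  exact pow_pos (sub_pos.2 (Real.sqrt_lt_sqrt hl.le (by linarith))) 2

/-- Completing the square: `x = √ρ` solves `x ^ 2 + 2 * x * √l = ε` when `(x + √l) ^ 2 = ε + l`. -/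
theorem rhoOf_add_two_mul_sqrt {ε δ : ℝ} (hε : 0 < ε) (hδ : 0 < δ) (hδ1 : δ < 1) :
    rhoOf ε δ + 2 * √(rhoOf ε δ * Real.log (1 / δ)) = ε := by
  unfold rhoOf
  have hl : 0 < Real.log (1 / δ) := Real.log_pos (by rw [lt_div_iff₀ hδ]; linarith)
  set l := Real.log (1 / δ)
  have hlt : √l < √(ε + l) := Real.sqrt_lt_sqrt hl.le (by linarith)
  have h1 : √l ^ 2 = l := Real.sq_sqrt hl.le
  have h2 : √(ε + l) ^ 2 = ε + l := Real.sq_sqrt (by linarith)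
  rw [Real.sqrt_mul (sq_nonneg _), Real.sqrt_sq (sub_pos.2 hlt).le]
  nlinarith

/-! ### Translations of Gaussian noise and their moments -/

section Gaussian

/-- The density of `N(d, v)` with respect to `N(0, v)`. -/
noncomputable def gaussianShiftDensity (v : ℝ≥0) (d z : ℝ) : ℝ≥0∞ :=
  ENNReal.ofReal (Real.exp ((2 * z * d - d ^ 2) / (2 * v)))

theorem measurable_gaussianShiftDensity (v : ℝ≥0) :
    Measurable (Function.uncurry (gaussianShiftDensity v)) := by
  unfold gaussianShiftDensity Function.uncurry
  fun_prop

theorem measurable_gaussianShiftDensity_right (v : ℝ≥0) (d : ℝ) :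
    Measurable (gaussianShiftDensity v d) :=
  (measurable_gaussianShiftDensity v).comp measurable_prodMk_left

theorem gaussianReal_eq_withDensity_shift (d : ℝ) {v : ℝ≥0} (hv : v ≠ 0) :
    gaussianReal d v = (gaussianReal 0 v).withDensity (gaussianShiftDensity v d) := by
  rw [gaussianReal_of_var_ne_zero _ hv, gaussianReal_of_var_ne_zero _ hv,
    ← withDensity_mul _ (measurable_gaussianPDF _ _)
      (measurable_gaussianShiftDensity_right v d)]
  congr 1
  ext z
  have hv' : (v : ℝ) ≠ 0 := by exact_mod_cast hv
  rw [Pi.mul_apply, gaussianPDF, gaussianPDF, gaussianShiftDensity,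
    ← ENNReal.ofReal_mul (gaussianPDFReal_nonneg _ _ _), gaussianPDFReal, gaussianPDFReal,
    mul_assoc _ (Real.exp _), ← Real.exp_add]
  congr 3
  field_simp
  ring

/-- The power is a constant times `exp (lam * d / v * z)`, so the integral is a value of the
Gaussian moment generating function. -/
theorem lintegral_gaussianShiftDensity_rpow (d : ℝ) {v : ℝ≥0} (hv : v ≠ 0) (lam : ℝ) :
    ∫⁻ z, gaussianShiftDensity v d z ^ lam ∂(gaussianReal 0 v)
      = ENNReal.ofReal (Real.exp (lam * (lam - 1) * (d ^ 2 / (2 * v)))) := by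
  have hv' : (v : ℝ) ≠ 0 := by exact_mod_cast hv
  have h1 : ∀ z, gaussianShiftDensity v d z ^ lam
      = ENNReal.ofReal (Real.exp (-(lam * d ^ 2 / (2 * v))))
        * ENNReal.ofReal (Real.exp (lam * d / v * z)) := by
    intro z
    rw [gaussianShiftDensity, ENNReal.ofReal_rpow_of_pos (Real.exp_pos _), ← Real.exp_mul,
      ← ENNReal.ofReal_mul (Real.exp_pos _).le, ← Real.exp_add]
    congr 2
    field_simp
    ring
  have h2 := congrFun (mgf_id_gaussianReal (μ := 0) (v := v)) (lam * d / v)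
  simp_rw [h1]
  rw [lintegral_const_mul _ (by fun_prop), ← ofReal_integral_eq_lintegral_ofReal
    (integrable_exp_mul_gaussianReal _) (ae_of_all _ fun _ => (Real.exp_pos _).le)]
  simp only [mgf, id] at h2
  rw [h2, ← ENNReal.ofReal_mul (Real.exp_pos _).le, ← Real.exp_add]
  congr 2
  field_simp
  ring

variable {ι : Type*} [Fintype ι]

theorem lintegral_pi_prod {X : ι → Type*} [∀ i, MeasurableSpace (X i)]
    (μ : ∀ i, Measure (X i)) [∀ i, IsProbabilityMeasure (μ i)] {f : ∀ i, X i → ℝ≥0∞}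
    (hf : ∀ i, Measurable (f i)) :
    ∫⁻ x, ∏ i, f i (x i) ∂(Measure.pi μ) = ∏ i, ∫⁻ x, f i x ∂(μ i) := by
  refine (lintegral_prod_eq_prod_lintegral_of_indepFun Finset.univ (fun i (x : ∀ i, X i) => f i (x i))
    (iIndepFun_pi fun i => (hf i).aemeasurable) fun i =>
      (hf i).comp (measurable_pi_apply i)).trans ?_
  exact Finset.prod_congr rfl fun i _ => (measurePreserving_eval μ i).lintegral_comp (hf i)

/-- Both sides agree on boxes, where the indicator factors over the coordinates. -/
theorem pi_withDensity {X : ι → Type*} [∀ i, MeasurableSpace (X i)]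
    (μ : ∀ i, Measure (X i)) [∀ i, IsProbabilityMeasure (μ i)] {f : ∀ i, X i → ℝ≥0∞}
    (hf : ∀ i, Measurable (f i)) [∀ i, SigmaFinite ((μ i).withDensity (f i))] :
    Measure.pi (fun i => (μ i).withDensity (f i))
      = (Measure.pi μ).withDensity (fun x => ∏ i, f i (x i)) := by
  refine Measure.pi_eq fun s hs => ?_
  rw [withDensity_apply _ (MeasurableSet.univ_pi hs),
    ← lintegral_indicator (MeasurableSet.univ_pi hs)]
  have : ∀ x, (Set.univ.pi s).indicator (fun x => ∏ i, f i (x i)) x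
      = ∏ i, (s i).indicator (f i) (x i) := by
    intro x
    by_cases hx : x ∈ Set.univ.pi s
    · rw [Set.indicator_of_mem hx]
      exact Finset.prod_congr rfl fun i _ => (Set.indicator_of_mem (hx i trivial) _).symm
    · rw [Set.indicator_of_notMem hx]
      simp only [Set.mem_pi, Set.mem_univ, true_implies, not_forall] at hx
      obtain ⟨i, hi⟩ := hx
      exact (Finset.prod_eq_zero (Finset.mem_univ i) (Set.indicator_of_notMem hi _)).symm
  simp_rw [this]
  rw [lintegral_pi_prod μ fun i => (hf i).indicator (hs i)]
  exact Finset.prod_congr rfl fun i _ => by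
    rw [lintegral_indicator (hs i), withDensity_apply _ (hs i)]

theorem pi_gaussianReal_map_add (v : ι → ℝ≥0) (hv : ∀ i, v i ≠ 0) (d : ι → ℝ) :
    (Measure.pi fun i => gaussianReal 0 (v i)).map (fun Z => Z + d)
      = (Measure.pi fun i => gaussianReal 0 (v i)).withDensity
        (fun Z => ∏ i, gaussianShiftDensity (v i) (d i) (Z i)) := by
  have hm : ∀ i, Measurable (gaussianShiftDensity (v i) (d i)) := fun i =>
    measurable_gaussianShiftDensity_right (v i) (d i)
  have (i : ι) : IsProbabilityMeasure
      ((gaussianReal 0 (v i)).withDensity (gaussianShiftDensity (v i) (d i))) := by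
    rw [← gaussianReal_eq_withDensity_shift _ (hv i)]; infer_instance
  rw [← pi_withDensity _ hm]
  simp_rw [← gaussianReal_eq_withDensity_shift _ (hv _)]
  have := Measure.pi_map_pi (μ := fun i => gaussianReal 0 (v i)) (f := fun i z => z + d i)
    (fun i => by fun_prop)
  simp only [gaussianReal_map_add_const, zero_add] at this
  exact this

variable {H : Type*} [MeasurableSpace H] {Ω : Type*} [MeasurableSpace Ω]

/-- The density of the joint law of `h` and the noise shifted by `d h` with respect to the joint
law of `h` and the noise. -/
noncomputable def jointShiftDensity (v : ι → ℝ≥0) (d : H → ι → ℝ) (x : H × (ι → ℝ)) : ℝ≥0∞ :=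
  ∏ i, gaussianShiftDensity (v i) (d x.1 i) (x.2 i)

theorem measurable_jointShiftDensity (v : ι → ℝ≥0) {d : H → ι → ℝ} (hd : Measurable d) :
    Measurable (jointShiftDensity v d) := by
  unfold jointShiftDensity
  refine Finset.measurable_prod _ fun i _ =>
    (measurable_gaussianShiftDensity (v i)).comp (Measurable.prodMk ?_ ?_)
  · exact (measurable_pi_apply i).comp (hd.comp measurable_fst)
  · exact (measurable_pi_apply i).comp measurable_snd

/-- The translation keeps `h` fixed, so Fubini reduces the claim to a constant shift on each fibre.
-/
theorem prod_gaussian_map_add (ν : Measure H) [IsProbabilityMeasure ν] (v : ι → ℝ≥0)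
    (hv : ∀ i, v i ≠ 0) {d : H → ι → ℝ} (hd : Measurable d) :
    (ν.prod (Measure.pi fun i => gaussianReal 0 (v i))).map (fun x => (x.1, x.2 + d x.1))
      = (ν.prod (Measure.pi fun i => gaussianReal 0 (v i))).withDensity
        (jointShiftDensity v d) := by
  have hT : Measurable fun x : H × (ι → ℝ) => (x.1, x.2 + d x.1) :=
    measurable_fst.prodMk (measurable_snd.add (hd.comp measurable_fst))
  have hg := measurable_jointShiftDensity v hd
  ext A hA
  rw [Measure.map_apply hT hA, Measure.prod_apply (hT hA), withDensity_apply _ hA,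
    ← lintegral_indicator hA, lintegral_prod _ (hg.indicator hA).aemeasurable]
  refine lintegral_congr fun h => ?_
  have hAh : MeasurableSet (Prod.mk h ⁻¹' A) := measurable_prodMk_left hA
  have hmap := pi_gaussianReal_map_add v hv (d h)
  have h1 := Measure.map_apply (μ := Measure.pi fun i => gaussianReal 0 (v i))
    (measurable_id.add_const (d h)) hAh
  simp only [id] at h1
  rw [hmap, withDensity_apply _ hAh, ← lintegral_indicator hAh] at h1
  exact h1.symm

theorem lintegral_jointShiftDensity_rpow_le (ν : Measure H) [IsProbabilityMeasure ν]
    (v : ι → ℝ≥0) (hv : ∀ i, v i ≠ 0) {d : H → ι → ℝ} (hd : Measurable d) {c : ℝ}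
    (hc : ∀ h, ∑ i, d h i ^ 2 / (2 * v i) ≤ c) {lam : ℝ} (hlam : 1 < lam) :
    ∫⁻ x, jointShiftDensity v d x ^ lam ∂(ν.prod (Measure.pi fun i => gaussianReal 0 (v i)))
      ≤ ENNReal.ofReal (Real.exp ((lam - 1) * (c * lam))) := by
  rw [lintegral_prod _ ((measurable_jointShiftDensity v hd).pow_const _).aemeasurable]
  have h0 : 0 ≤ lam := by linarith
  have hin : ∀ h, ∫⁻ Z, jointShiftDensity v d (h, Z) ^ lam
        ∂(Measure.pi fun i => gaussianReal 0 (v i))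
      ≤ ENNReal.ofReal (Real.exp ((lam - 1) * (c * lam))) := by
    intro h
    simp only [jointShiftDensity]
    -- For fixed `h` the coordinates are independent: moments multiply and their exponents add up to
    -- the sum bounded by `hc`.
    simp_rw [← ENNReal.prod_rpow_of_nonneg h0]
    rw [lintegral_pi_prod _ fun i =>
      (measurable_gaussianShiftDensity_right (v i) (d h i)).pow_const lam]
    simp_rw [lintegral_gaussianShiftDensity_rpow _ (hv _)]
    rw [← ENNReal.ofReal_prod_of_nonneg fun i _ => (Real.exp_pos _).le, ← Real.exp_sum,
      ← Finset.mul_sum]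
    refine ENNReal.ofReal_le_ofReal (Real.exp_le_exp.2 ?_)
    have : 0 ≤ lam * (lam - 1) := mul_nonneg h0 (by linarith)
    linarith [mul_le_mul_of_nonneg_left (hc h) this]
  refine (lintegral_mono hin).trans ?_
  simp

/-- The Gaussian mechanism conditionally on public randomness `h`: a shift `d h` of the noise,
followed by post-processing. -/
theorem renyiDiv_map_gaussian_shift_le (ν : Measure H) [IsProbabilityMeasure ν] (v : ι → ℝ≥0)
    (hv : ∀ i, v i ≠ 0) {d : H → ι → ℝ} (hd : Measurable d) {c : ℝ}
    (hc : ∀ h, ∑ i, d h i ^ 2 / (2 * v i) ≤ c) {f : H × (ι → ℝ) → Ω} (hf : Measurable f)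
    {lam : ℝ} (hlam : 1 < lam) :
    renyiDiv lam
      ((ν.prod (Measure.pi fun i => gaussianReal 0 (v i))).map fun x => f (x.1, x.2 + d x.1))
      ((ν.prod (Measure.pi fun i => gaussianReal 0 (v i))).map f) ≤ ((c * lam : ℝ) : EReal) := by
  have hT : Measurable fun x : H × (ι → ℝ) => (x.1, x.2 + d x.1) :=
    measurable_fst.prodMk (measurable_snd.add (hd.comp measurable_fst))
  have hmap := Measure.map_map (μ := ν.prod (Measure.pi fun i => gaussianReal 0 (v i))) hf hT
  rw [prod_gaussian_map_add ν v hv hd] at hmap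
  have h := renyiDiv_map_withDensity_le _ (measurable_jointShiftDensity v hd) hf hlam
    (lintegral_jointShiftDensity_rpow_le ν v hv hd hc hlam)
  rw [hmap] at h
  exact h

end Gaussian

/-! ### Completed sketches, sensitivity of the counters and budget accounting -/

namespace Params

variable {E : Type*} {n : ℕ} (p : Params)

theorem L_pos (hw : 1 ≤ p.w) : 0 < p.L :=
  Nat.ceil_pos.2 (Real.rpow_pos_of_pos (by exact_mod_cast hw) _)

variable {p} in
/-- The counters of a PCMS that has received all its items by time `t` are final. -/
theorem countersAt_eq_final (S : Fin n → E) (h : p.Hashes n E) (Z : p.Counters n) {t : ℕ}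
    {k : Fin (p.numSub n)} {j : p.Idx}
    (hc : ∀ i : Fin n, (i : ℕ) / p.L = k → p.receives k j (i + 1) → (i : ℕ) + 1 ≤ t)
    (r : Fin p.a) (c : Fin p.b) :
    p.countersAt S h Z t (k, j, r, c) = p.countersAt S h Z n (k, j, r, c) := by
  unfold countersAt
  congr 3
  ext i
  simp only [Finset.mem_filter, Finset.mem_univ, true_and]
  constructor
  · rintro ⟨-, h1, h2, h3⟩
    exact ⟨i.2, h1, h2, h3⟩
  · rintro ⟨-, h1, h2, h3⟩
    exact ⟨hc i h1 h2, h1, h2, h3⟩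

variable {p} in
theorem cmsQuery_eq_final (S : Fin n → E) (h : p.Hashes n E) (Z : p.Counters n) {t : ℕ}
    {k : Fin (p.numSub n)} {j : p.Idx}
    (hc : ∀ i : Fin n, (i : ℕ) / p.L = k → p.receives k j (i + 1) → (i : ℕ) + 1 ≤ t) (e : E) :
    p.cmsQuery h (p.countersAt S h Z t) k j e = p.cmsQuery h (p.countersAt S h Z n) k j e := by
  unfold cmsQuery
  exact iInf_congr fun r => countersAt_eq_final S h Z hc r _

theorem selectPrefix_completed {k t i : ℕ} {j : p.Idx} (hL : 0 < p.L)
    (hj : p.selectPrefix k t = some j) (hi : i / p.L = k) (hr : p.receives k j (i + 1)) :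
    i + 1 ≤ t := by
  unfold selectPrefix at hj
  split_ifs at hj with h
  · have := Nat.lt_mul_div_succ i hL
    rw [hi] at this
    unfold start at h
    nlinarith [Nat.sub_add_cancel (show 1 ≤ k * p.L + 1 + p.L by omega)]
  · obtain ⟨m, hm, rfl⟩ := Option.map_eq_some_iff.1 hj
    have := List.find?_some hm
    simp only [decide_eq_true_eq] at this
    -- For a prefix sketch, `hr` unfolds to `i + 1 ≤ p.v k m`.
    exact le_trans hr this

theorem succ_le_of_div_lt {k t i L : ℕ} (hL : 0 < L) (hk : k < (t - 1) / L) (hi : i / L = k) :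
    i + 1 ≤ t := by
  have h1 : (k + 1) * L ≤ t - 1 := (Nat.le_div_iff_mul_le hL).1 hk
  have h2 := Nat.lt_mul_div_succ i hL
  rw [hi, mul_comm] at h2
  omega

/-- The estimates only depend on the final values of the counters. -/
theorem freqQuery_eq_final (hL : 0 < p.L) (S : Fin n → E) (h : p.Hashes n E) (Z : p.Counters n)
    (t : ℕ) (e : E) :
    p.freqQuery h (p.countersAt S h Z t) t e = p.freqQuery h (p.countersAt S h Z n) t e := by
  refine Finset.sum_congr rfl fun k _ => ?_
  split_ifs with h1 h2 h3
  · cases hj : p.selectPrefix k t with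
    | none => rfl
    | some j =>
      exact cmsQuery_eq_final S h Z (fun i hi hr => p.selectPrefix_completed hL hj hi hr) e
  · exact cmsQuery_eq_final S h Z (fun i hi _ => succ_le_of_div_lt hL h2.2 hi) e
  · exact cmsQuery_eq_final S h Z (fun i hi _ => succ_le_of_div_lt hL h3.2 hi) e
  · rfl

/-- The change of the final counters when `S'` is replaced by `S`. -/
noncomputable def counterShift (S S' : Fin n → E) (h : p.Hashes n E) : p.Counters n :=
  p.countersAt S h 0 n - p.countersAt S' h 0 n

/-- The counts enter the counters additively, so their change can be moved into the noise; all other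
outputs are functions of the hashes and the final counters. -/
theorem run_eq_run_shift (hL : 0 < p.L) (γ ζ : ℝ) (S S' : Fin n → E)
    (x : p.Hashes n E × p.Counters n) :
    p.run γ ζ S x = p.run γ ζ S' (x.1, x.2 + p.counterShift S S' x.1) := by
  have hC : p.countersAt S x.1 x.2 n
      = p.countersAt S' x.1 (x.2 + p.counterShift S S' x.1) n := by
    ext s
    simp only [counterShift, countersAt, Pi.add_apply, Pi.sub_apply, Pi.zero_apply, zero_add]
    ring
  unfold run
  simp only [p.freqQuery_eq_final hL, hC]

/-- The shift is a difference of two indicators, whose square is at most their sum. The condition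
`receives` is dropped: every PCMS of the substream is charged, whether or not it gets the item. -/
theorem counterShift_sq_le {S S' : Fin n → E} {i : Fin n} (hi : ∀ j, j ≠ i → S j = S' j)
    (h : p.Hashes n E) (s : p.Slot n) :
    p.counterShift S S' h s ^ 2 ≤ if (i : ℕ) / p.L = s.1 then
      (if h (s.1, s.2.1) s.2.2.1 (S i) = s.2.2.2 then 1 else 0)
        + (if h (s.1, s.2.1) s.2.2.1 (S' i) = s.2.2.2 then 1 else 0) else 0 := by
  classical
  have key : p.counterShift S S' h s
      = (if (i : ℕ) + 1 ≤ n ∧ (i : ℕ) / p.L = s.1 ∧ p.receives s.1 s.2.1 (i + 1) ∧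
          h (s.1, s.2.1) s.2.2.1 (S i) = s.2.2.2 then 1 else 0)
        - (if (i : ℕ) + 1 ≤ n ∧ (i : ℕ) / p.L = s.1 ∧ p.receives s.1 s.2.1 (i + 1) ∧
          h (s.1, s.2.1) s.2.2.1 (S' i) = s.2.2.2 then 1 else 0) := by
    simp only [counterShift, countersAt, Pi.sub_apply, Pi.zero_apply, zero_add,
      Finset.natCast_card_filter]
    rw [← Finset.sum_sub_distrib, Finset.sum_eq_single i]
    · intro j _ hj
      rw [hi j hj, sub_self]
    · simp
  rw [key]
  by_cases h1 : (i : ℕ) / p.L = s.1 <;> by_cases h2 : p.receives s.1 s.2.1 (i + 1) <;>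
    by_cases h3 : h (s.1, s.2.1) s.2.2.1 (S i) = s.2.2.2 <;>
    by_cases h4 : h (s.1, s.2.1) s.2.2.1 (S' i) = s.2.2.2 <;>
    simp [h1, h2, h3, h4]

theorem budget_pos (hα : 0 < p.α ∧ p.α < 1) {ρ : ℝ} (hρ : 0 < ρ) (j : p.Idx) :
    0 < p.budget ρ j := by
  obtain ⟨h0, h1⟩ := hα
  have h2 : 0 < 1 - p.α := by linarith
  rcases j with _ | j | j
  · simp only [budget]
    exact mul_pos hρ (by nlinarith)
  all_goals
    simp only [budget]
    positivity

/-- Prefix and suffix sketches each total at most `ρ * (1 - α) ^ 2 / 2` by the geometric series, and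
`(2 * α - α ^ 2) + (1 - α) ^ 2 = 1`. -/
theorem sum_budget_le (hα : 0 < p.α ∧ p.α < 1) {ρ : ℝ} (hρ : 0 < ρ) :
    ∑ j, p.budget ρ j ≤ ρ := by
  obtain ⟨h0, h1⟩ := hα
  have h2 : 0 < 1 - p.α := by linarith
  have hg : (∑ i : Fin (p.I.length - 1), p.α ^ (i : ℕ)) * (1 - p.α) ≤ 1 := by
    rw [Fin.sum_univ_eq_sum_range (fun i => p.α ^ i), geom_sum_mul_neg]
    linarith [pow_pos h0 (p.I.length - 1)]
  simp only [Fintype.sum_sum_type, budget, Finset.univ_unique, Finset.sum_singleton]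
  have : ∑ i : Fin (p.I.length - 1), ρ * p.α ^ (i : ℕ) * (1 - p.α) ^ 3 / 2
      = ρ * (1 - p.α) ^ 2 / 2
        * ((∑ i : Fin (p.I.length - 1), p.α ^ (i : ℕ)) * (1 - p.α)) := by
    rw [Finset.sum_mul, Finset.mul_sum]
    exact Finset.sum_congr rfl fun i _ => by ring
  rw [this]
  have h3 : 0 ≤ ρ * (1 - p.α) ^ 2 / 2 := by positivity
  nlinarith [mul_le_mul_of_nonneg_left hg h3]

theorem sum_counterShift_sq_le (ha : 1 ≤ p.a) (hα : 0 < p.α ∧ p.α < 1) {ρ : ℝ} (hρ : 0 < ρ)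
    {S S' : Fin n → E} (hS : Neighboring S S') (h : p.Hashes n E) :
    ∑ s, p.counterShift S S' h s ^ 2 / (2 * Real.toNNReal ((p.a : ℝ) / p.budget ρ s.2.1)) ≤ ρ := by
  obtain ⟨i, -, hi⟩ := hS
  have ha' : (0 : ℝ) < p.a := by exact_mod_cast ha
  have hb := p.budget_pos hα hρ
  refine le_trans (Finset.sum_le_sum (g := fun s : p.Slot n =>
    (if (i : ℕ) / p.L = s.1 then
      ((if h (s.1, s.2.1) s.2.2.1 (S i) = s.2.2.2 then 1 else 0)
        + (if h (s.1, s.2.1) s.2.2.1 (S' i) = s.2.2.2 then 1 else 0)) *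
          (p.budget ρ s.2.1 / (2 * p.a)) else 0)) fun s _ => ?_) ?_
  · have hv : (2 * (Real.toNNReal ((p.a : ℝ) / p.budget ρ s.2.1) : ℝ))⁻¹
        = p.budget ρ s.2.1 / (2 * p.a) := by
      rw [Real.coe_toNNReal _ (div_pos ha' (hb _)).le]
      have := (hb s.2.1).ne'
      field_simp
    rw [div_eq_mul_inv, hv, ← ite_zero_mul]
    exact mul_le_mul_of_nonneg_right (p.counterShift_sq_le hi h s)
      (div_pos (hb _) (by positivity)).le
  · simp only [Fintype.sum_prod_type]
    have hinner : ∀ (k : Fin (p.numSub n)) (j : p.Idx), (∑ r : Fin p.a, ∑ c : Fin p.b,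
        if (i : ℕ) / p.L = k then
          ((if h (k, j) r (S i) = c then 1 else 0) + (if h (k, j) r (S' i) = c then 1 else 0)) *
            (p.budget ρ j / (2 * p.a)) else 0)
        = if (i : ℕ) / p.L = k then p.budget ρ j else 0 := by
      intro k j
      split_ifs with hk
      · simp_rw [← Finset.sum_mul, Finset.sum_add_distrib]
        -- In each row the two indicators sum to `2` over the columns; the `a` rows give `2 * a`,
        -- cancelling the denominator.
        simp only [Finset.sum_ite_eq, Finset.mem_univ, if_true, Finset.sum_const,
          Finset.card_univ, Fintype.card_fin, nsmul_eq_mul]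
        field_simp
        ring
      · simp
    simp_rw [hinner]
    have hk : ∀ k : Fin (p.numSub n), (∑ j, if (i : ℕ) / p.L = k then p.budget ρ j else 0)
        = if (i : ℕ) / p.L = k then ∑ j, p.budget ρ j else 0 := by
      intro k
      split_ifs <;> simp
    simp_rw [hk]
    -- Only the substream of the changed item contributes. An index beyond the last substream would
    -- give an empty sum, so no arithmetic with `numSub` is needed.
    by_cases hex : (i : ℕ) / p.L < p.numSub n
    · rw [Finset.sum_eq_single ⟨(i : ℕ) / p.L, hex⟩]
      · simpa using p.sum_budget_le hα hρ
      · intro k _ hne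
        exact if_neg fun hik => hne (Fin.ext hik.symm)
      · simp
    · rw [Finset.sum_eq_zero fun (k : Fin (p.numSub n)) _ =>
        if_neg fun hik : (i : ℕ) / p.L = k => hex (hik ▸ k.2)]
      exact hρ.le

theorem isZCDP_mechanism [Finite E] (γ ζ : ℝ) (hw : 1 ≤ p.w) (ha : 1 ≤ p.a)
    (hα : 0 < p.α ∧ p.α < 1) {ρ : ℝ} (hρ : 0 < ρ) (ν : Measure (p.Hashes n E))
    [IsProbabilityMeasure ν] : IsZCDP (p.mechanism γ ζ ρ ν) ρ := by
  intro S S' hS lam hlam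
  have hrun : p.run γ ζ S = fun x => p.run γ ζ S' (x.1, x.2 + p.counterShift S S' x.1) :=
    funext (p.run_eq_run_shift (p.L_pos hw) γ ζ S S')
  unfold mechanism
  rw [hrun]
  -- The shift is measurable in the hashes because they form a finite space, `E` being finite.
  refine renyiDiv_map_gaussian_shift_le ν _ (fun s => ?_) (measurable_of_finite _)
    (p.sum_counterShift_sq_le ha hα hρ hS) (p.measurable_run γ ζ S') hlam
  exact (Real.toNNReal_pos.2
    (div_pos (by exact_mod_cast ha) (p.budget_pos hα hρ s.2.1))).ne'

end Params

end DPSW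

theorem mainTheorem1 {E : Type*} [Finite E] (n : ℕ) (p : DPSW.Params) (γ ζ : ℝ)
    (hw : 1 ≤ p.w) (ha : 1 ≤ p.a) (hb : 1 ≤ p.b)
    (hα : 0 < p.α ∧ p.α < 1) (hβ : 0 < p.β ∧ p.β < 1)
    (ν : MeasureTheory.Measure (p.Hashes n E)) [MeasureTheory.IsProbabilityMeasure ν] :
    (∀ ρ : ℝ, 0 < ρ →
      DPSW.IsZCDP (p.mechanism γ ζ ρ ν) ρ ∧
      ∀ δ : ℝ, 0 < δ → δ < 1 →
        DPSW.IsDP (p.mechanism γ ζ ρ ν) (ρ + 2 * √(ρ * Real.log (1 / δ))) δ) ∧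
    (∀ ε δ : ℝ, 0 < ε → 0 < δ → δ < 1 →
      0 < DPSW.rhoOf ε δ ∧
      DPSW.rhoOf ε δ + 2 * √(DPSW.rhoOf ε δ * Real.log (1 / δ)) = ε ∧
      DPSW.IsDP (p.mechanism γ ζ (DPSW.rhoOf ε δ) ν) ε δ) := by
  have hz : ∀ ρ : ℝ, 0 < ρ → DPSW.IsZCDP (p.mechanism γ ζ ρ ν) ρ := fun ρ hρ =>
    p.isZCDP_mechanism γ ζ hw ha hα hρ ν
  refine ⟨fun ρ hρ => ⟨hz ρ hρ, fun δ hδ hδ1 => (hz ρ hρ).isDP hρ hδ hδ1⟩,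
    fun ε δ hε hδ hδ1 => ?_⟩
  have hρ := DPSW.rhoOf_pos hε hδ hδ1
  have heq := DPSW.rhoOf_add_two_mul_sqrt hε hδ hδ1
  refine ⟨hρ, heq, ?_⟩
  have h := (hz _ hρ).isDP hρ hδ hδ1
  rwa [heq] at h
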